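/- Let $T,d\in\mathbb N$, let $\mu_1,\dots,\mu_T$ be probability measures on $\mathbb R^d\times\mathbb R$, and for each task $t\in\{1,\dots,T\}$ let $(x_{ti},y_{ti})$, $i=1,\dots,m_t$, be drawn from $\mu_t$, all examples being independent. Let $\gamma,\beta>0$. Call $(A,a_0,U)$ feasible if $A=[a_1,\dots,a_T]\in\mathbb R^{d\times T}$, $a_0\in\mathbb R^d$, $U\in\mathbb R^{d\times d}$ is orthogonal, $$\|A\|_{2,1}^2\le \frac T\gamma\qquad\text{and}\qquad \|a_0\|_2^2\le\frac1\beta ,$$ where $\|A\|_{2,1}$ is the sum of the Euclidean norms of the rows of $A$. Let $H$ be the class of linear functions $x\mapsto\langle a_t+a_0,U^{\top}x\rangle$ with $(A,a_0,U)$ feasible and $1\le t\le T$. Let $D\subseteq\mathbb R^d\times\mathbb R$ be a set that contains $\mu_t$-almost every example for every $t$, and let $l:\mathbb R\times\mathbb R\to\mathbb R$ be a measurable loss function such that, for all $h,h'\in H$ and $(x,y)\in D$, $$0\le l(y,h(x))\le B,\qquad |l(y,h(x))-l(y,h'(x))|\le c\,|h(x)-h'(x)|$$ with a constant $c\ge 0$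 (that is, $l$ is bounded by $B$ and $c$-admissible with respect to $H$). Put $S(X_t)=\frac1{m_t}\sum_{i=1}^{m_t}\|x_{ti}\|_2^2$ and let $\delta>0$. (1) With probability at least $1-\delta$ over the sample, simultaneously for all feasible $(A,a_0,U)$ (in particular for every minimizer of the empirical loss under these constraints), $$\mathbb E\sum_{t=1}^T\sum_{i=1}^{m_t} l\big(y_{ti},\langle a_t+a_0,U^{\top}x_{ti}\rangle\big)-\sum_{t=1}^T\sum_{i=1}^{m_t} l\big(y_{ti},\langle a_t+a_0,U^{\top}x_{ti}\rangle\big)\le 2c\Big(\sqrt{\tfrac T\gamma}+\sqrt{\tfrac1\beta}\Big)\sqrt{\sum_{t=1}^T m_tS(X_t)}+3B\sqrt{\frac{\sum_{t=1}^T m_t\ln(2/\delta)}{2}},$$ where the expectation is over the examples with $(A,a_0,U)$ held fixed. (2) If $T\ge1$, $m_1=\dots=m_T=m\ge1$ and $\|x\|_2\le r$ for $\mu_t$-almost every $(x,y)$ and every $t$, then with probability at least $1-\delta$, simultaneously for all feasible $(A,a_0,U)$, $$\frac1T\sum_{t=1}^T\mathbb E_{(x,y)\sim\mu_t}\, l\big(y,\langle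 a_t+a_0,U^{\top}x\rangle\big)-\frac1T\sum_{t=1}^T\frac1m\sum_{i=1}^m l\big(y_{ti},\langle a_t+a_0,U^{\top}x_{ti}\rangle\big)\le\frac{2cr}{\sqrt{\gamma m}}+\frac{2cr}{\sqrt{\beta mT}}+3B\sqrt{\frac{\ln(2/\delta)}{2mT}} .$$ -/

import Mathlib

open MeasureTheory

namespace MTMF

noncomputable section

/-- An example `(x, y)` with feature vector `x ∈ ℝ^d` and output `y ∈ ℝ`. -/
abbrev Example (d : ℕ) : Type := EuclideanSpace ℝ (Fin d) × ℝ

/-- A multi-task sample: `m t` examples for each task `t`. -/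
abbrev Sample (d T : ℕ) (m : Fin T → ℕ) : Type := (Σ t : Fin T, Fin (m t)) → Example d

/-- The law of a multi-task sample: all examples are independent, and every example of task `t`
has law `μ t`. -/
def sampleLaw {d T : ℕ} (μ : Fin T → Measure (Example d)) (m : Fin T → ℕ) :
    Measure (Sample d T m) :=
  Measure.pi fun p => μ p.1

/-- `‖A‖_{2,1}`, the sum of the Euclidean norms of the rows of `A`. -/
def norm21 {d T : ℕ} (A : Matrix (Fin d) (Fin T) ℝ) : ℝ :=
  ∑ i, ‖(WithLp.toLp 2 fun t => A i t : EuclideanSpace ℝ (Fin T))‖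

/-- The predictor of task `t`: `x ↦ ⟨a_t + a₀, Uᵀ x⟩`, where `a_t` is the `t`-th column of `A`. -/
def predictor {d T : ℕ} (A : Matrix (Fin d) (Fin T) ℝ) (a₀ : EuclideanSpace ℝ (Fin d))
    (U : Matrix (Fin d) (Fin d) ℝ) (t : Fin T) (x : EuclideanSpace ℝ (Fin d)) : ℝ :=
  inner ℝ ((WithLp.toLp 2 fun i => A i t : EuclideanSpace ℝ (Fin d)) + a₀)
    (WithLp.toLp 2 (U.transpose.mulVec x.ofLp) : EuclideanSpace ℝ (Fin d))

/-- The hard constraints: `U` is orthogonal, `‖A‖_{2,1}² ≤ T / γ` and `‖a₀‖² ≤ 1 / β`. -/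
def Feasible {d T : ℕ} (γ β : ℝ) (A : Matrix (Fin d) (Fin T) ℝ) (a₀ : EuclideanSpace ℝ (Fin d))
    (U : Matrix (Fin d) (Fin d) ℝ) : Prop :=
  U ∈ Matrix.orthogonalGroup (Fin d) ℝ ∧ norm21 A ^ 2 ≤ (T : ℝ) / γ ∧ ‖a₀‖ ^ 2 ≤ 1 / β

/-- The class of linear functions that the constrained problem uses as predictors of its tasks. -/
def hypothesisClass (d T : ℕ) (γ β : ℝ) : Set (EuclideanSpace ℝ (Fin d) → ℝ) :=
  {h | ∃ (A : Matrix (Fin d) (Fin T) ℝ) (a₀ : EuclideanSpace ℝ (Fin d))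
    (U : Matrix (Fin d) (Fin d) ℝ) (t : Fin T), Feasible γ β A a₀ U ∧ h = predictor A a₀ U t}

/-- The loss `l` is `c`-admissible with respect to the class `H`, on the set `D` of examples. -/
def IsAdmissible {d : ℕ} (l : ℝ → ℝ → ℝ) (c : ℝ) (H : Set (EuclideanSpace ℝ (Fin d) → ℝ))
    (D : Set (Example d)) : Prop :=
  0 ≤ c ∧ ∀ h ∈ H, ∀ h' ∈ H, ∀ z ∈ D, |l z.2 (h z.1) - l z.2 (h' z.1)| ≤ c * |h z.1 - h' z.1|

/-- The loss `l` takes values in `[0, B]` on the class `H` and the set `D` of examples. -/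
def IsBoundedLoss {d : ℕ} (l : ℝ → ℝ → ℝ) (B : ℝ) (H : Set (EuclideanSpace ℝ (Fin d) → ℝ))
    (D : Set (Example d)) : Prop :=
  ∀ h ∈ H, ∀ z ∈ D, 0 ≤ l z.2 (h z.1) ∧ l z.2 (h z.1) ≤ B

/-- The total empirical loss `∑_t ∑_i l(y_{ti}, ⟨a_t + a₀, Uᵀ x_{ti}⟩)`. -/
def empiricalLoss {d T : ℕ} {m : Fin T → ℕ} (l : ℝ → ℝ → ℝ) (A : Matrix (Fin d) (Fin T) ℝ)
    (a₀ : EuclideanSpace ℝ (Fin d)) (U : Matrix (Fin d) (Fin d) ℝ) (S : Sample d T m) : ℝ :=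
  ∑ t, ∑ i : Fin (m t), l (S ⟨t, i⟩).2 (predictor A a₀ U t (S ⟨t, i⟩).1)

/-- `S(X_t) = (1 / m_t) ∑_i ‖x_{ti}‖²`, the trace of the empirical (uncentred) covariance. -/
def covTrace {d T : ℕ} {m : Fin T → ℕ} (S : Sample d T m) (t : Fin T) : ℝ :=
  1 / (m t : ℝ) * ∑ i : Fin (m t), ‖(S ⟨t, i⟩).1‖ ^ 2

end

end MTMF

/-!
The deviation of the empirical loss is controlled through Rademacher averages.

The largest deviation `Φ` over the class and the empirical Rademacher average `R` of the losses
change by at most `B` when one example is replaced, so McDiarmid's inequality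
(`measureReal_pi_lt_sub_integral_le`, deduced from Hoeffding's lemma by tensorization) bounds
`Φ - 𝔼 Φ` and `𝔼 R - R` by `B * √(N log (2 / δ) / 2)` with probability `1 - δ / 2` each, `N` being
the number of examples. Symmetrization (`integral_ciSup_deviation_le`) gives `𝔼 Φ ≤ 2 𝔼 R`, whence
`Φ ≤ 2 R + 3 B √(N log (2 / δ) / 2)` (`measureReal_exists_deviation_le`).

The contraction principle (`rademacherAvg_le_of_abs_sub_le`) replaces the losses in `R` by the
predictors at the cost of a factor `c`. For the predictors, the orthogonal matrix preserves norms,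
the Frobenius norm of `A` is at most `‖A‖_{2,1} ≤ √(T / γ)`, and signed sums of vectors have mean
square norm `∑ ‖x‖²`; Cauchy-Schwarz and Jensen then give `rademacherAvg_predictor_le`.

Suprema are taken only over finite families, which avoids measurability and boundedness questions.
Since the final bound does not depend on the family, it passes to a dense sequence of feasible
triples by continuity from below, and to all feasible triples because, for almost every sample, the
loss and its mean are continuous in the parameters (`exists_measurableSet_forall_feasible`). The
bound for the averages over tasks is the bound for the totals divided by the number of examples.
-/

namespace MTMF

/-! ### The bounded differences inequality -/

section BoundedDifferences

open ProbabilityTheory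

variable {Z W : Type*} [MeasurableSpace Z] [MeasurableSpace W]

/-- Tensorization: conditioning on the second coordinate splits the centred variable into two parts,
and the sub-Gaussian parameters add up. -/
lemma HasSubgaussianMGF.prod {ρ : Measure Z} {π : Measure W} [IsProbabilityMeasure ρ]
    [IsProbabilityMeasure π] {F : Z × W → ℝ} {C : ℝ} {c₁ c₂ : NNReal} (hF : Measurable F)
    (hC : ∀ p, |F p| ≤ C)
    (h₁ : ∀ w, HasSubgaussianMGF (fun z => F (z, w) - ∫ z', F (z', w) ∂ρ) c₁ ρ)
    (h₂ : HasSubgaussianMGF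
      (fun w => (∫ z, F (z, w) ∂ρ) - ∫ w', ∫ z, F (z, w') ∂ρ ∂π) c₂ π) :
    HasSubgaussianMGF (fun p => F p - ∫ q, F q ∂(ρ.prod π)) (c₁ + c₂) (ρ.prod π) := by
  have hFi : Integrable F (ρ.prod π) :=
    Integrable.of_bound hF.aestronglyMeasurable C (Filter.Eventually.of_forall hC)
  have hmean : ∫ q, F q ∂(ρ.prod π) = ∫ w, ∫ z, F (z, w) ∂ρ ∂π := integral_prod_symm _ hFi
  have hint : ∀ t : ℝ, Integrable
      (fun p => Real.exp (t * (F p - ∫ q, F q ∂(ρ.prod π)))) (ρ.prod π) := fun t =>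
    integrable_exp_mul_of_mem_Icc (a := -C - ∫ q, F q ∂(ρ.prod π))
      (b := C - ∫ q, F q ∂(ρ.prod π)) (hF.sub_const _).aemeasurable
      (Filter.Eventually.of_forall fun p =>
        ⟨sub_le_sub_right (abs_le.1 (hC p)).1 _, sub_le_sub_right (abs_le.1 (hC p)).2 _⟩)
  refine ⟨hint, fun t => ?_⟩
  rw [mgf, integral_prod_symm _ (hint t)]
  calc ∫ w, ∫ z, Real.exp (t * (F (z, w) - ∫ q, F q ∂(ρ.prod π))) ∂ρ ∂π
      ≤ ∫ w, Real.exp (c₁ * t ^ 2 / 2) *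
          Real.exp (t * ((∫ z, F (z, w) ∂ρ) - ∫ w', ∫ z, F (z, w') ∂ρ ∂π)) ∂π := by
        refine integral_mono (hint t).integral_prod_right
          ((h₂.integrable_exp_mul t).const_mul _) fun w => ?_
        have hsplit : ∀ z, Real.exp (t * (F (z, w) - ∫ q, F q ∂(ρ.prod π))) =
            Real.exp (t * (F (z, w) - ∫ z', F (z', w) ∂ρ)) *
            Real.exp (t * ((∫ z, F (z, w) ∂ρ) - ∫ w', ∫ z, F (z, w') ∂ρ ∂π)) := fun z => by
          rw [← Real.exp_add, hmean]; ring_nf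
        simp_rw [hsplit]
        rw [integral_mul_const]
        exact mul_le_mul_of_nonneg_right ((h₁ w).mgf_le t) (Real.exp_pos _).le
    _ ≤ Real.exp (c₁ * t ^ 2 / 2) * Real.exp (c₂ * t ^ 2 / 2) := by
        rw [integral_const_mul]
        exact mul_le_mul_of_nonneg_left (h₂.mgf_le t) (Real.exp_pos _).le
    _ = Real.exp ((c₁ + c₂ : NNReal) * t ^ 2 / 2) := by
        rw [← Real.exp_add]; push_cast; ring_nf

/-- Hoeffding's lemma, with the range given by its diameter. -/
lemma hasSubgaussianMGF_of_abs_sub_le {ρ : Measure Z} [IsProbabilityMeasure ρ] {X : Z → ℝ}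
    {B : NNReal} (hX : Measurable X) (hB : ∀ z z', |X z - X z'| ≤ B) :
    HasSubgaussianMGF (fun z => X z - ∫ z', X z' ∂ρ) ((B / 2) ^ 2) ρ := by
  have : Nonempty Z := nonempty_of_isProbabilityMeasure ρ
  have hbdd : BddBelow (Set.range X) :=
    ⟨X (Classical.arbitrary Z) - B, by
      rintro _ ⟨z, rfl⟩
      linarith [(abs_le.1 (hB z (Classical.arbitrary Z))).1]⟩
  have := hasSubgaussianMGF_of_mem_Icc (μ := ρ) (a := ⨅ z, X z) (b := (⨅ z, X z) + B)
    hX.aemeasurable (Filter.Eventually.of_forall fun z => ⟨ciInf_le hbdd z, ?_⟩)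
  · simpa using this
  · rw [← sub_le_iff_le_add]
    exact le_ciInf fun z' => by linarith [(abs_le.1 (hB z z')).2]

lemma hasSubgaussianMGF_pi_fin {B : NNReal} {C : ℝ} : ∀ (n : ℕ) (ν : Fin n → Measure Z)
    [∀ i, IsProbabilityMeasure (ν i)] (f : (Fin n → Z) → ℝ), Measurable f → (∀ S, |f S| ≤ C) →
    (∀ S i z, |f (Function.update S i z) - f S| ≤ B) →
    HasSubgaussianMGF (fun S => f S - ∫ S', f S' ∂(Measure.pi ν)) (n * (B / 2) ^ 2)
      (Measure.pi ν)
  | 0, ν, _, f, _, _, _ => by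
    have : (fun S => f S - ∫ S', f S' ∂(Measure.pi ν)) = fun _ => 0 := by
      funext S
      have : ∀ S', f S' = f S := fun S' => congrArg f (Subsingleton.elim _ _)
      simp [this]
    rw [this]
    simp
  | n + 1, ν, _, f, hf, hC, hB => by
    have mp := (measurePreserving_piFinSuccAbove ν 0).symm
    set e := (MeasurableEquiv.piFinSuccAbove (fun _ : Fin (n + 1) => Z) 0).symm with he
    have he' : ∀ z s, e (z, s) = Fin.cons z s := fun z s => by
      rw [he]; simp [Fin.consEquiv]
    set π := Measure.pi fun j : Fin n => ν (Fin.succAbove 0 j)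
    have hFm : Measurable (f ∘ e) := hf.comp e.measurable
    have hG := hasSubgaussianMGF_pi_fin n (fun j => ν (Fin.succAbove 0 j))
      (fun s => ∫ z, f (e (z, s)) ∂(ν 0))
      (StronglyMeasurable.integral_prod_left' hFm.stronglyMeasurable).measurable
      (fun s => by
        have := norm_integral_le_of_norm_le_const (μ := ν 0) (f := fun z => f (e (z, s)))
          (Filter.Eventually.of_forall fun z => hC _)
        simpa using this)
      (fun s i z => by
        have hint : ∀ s, Integrable (fun z => f (e (z, s))) (ν 0) := fun s =>
          Integrable.of_bound (hFm.comp (measurable_id.prodMk measurable_const)).aestronglyMeasurable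
            C (Filter.Eventually.of_forall fun z => hC _)
        rw [← integral_sub (hint _) (hint _)]
        have := norm_integral_le_of_norm_le_const (μ := ν 0)
          (f := fun x => f (e (x, Function.update s i z)) - f (e (x, s))) (C := B)
          (Filter.Eventually.of_forall fun x => by
            rw [he', he', Fin.cons_update]
            exact hB _ _ _)
        simpa using this)
    have key := HasSubgaussianMGF.prod (ρ := ν 0) (π := π) (F := f ∘ e) (C := C)
      (c₁ := (B / 2) ^ 2) hFm (fun p => hC _)
      (fun s => hasSubgaussianMGF_of_abs_sub_le (X := fun z => f (e (z, s)))
        (hFm.comp (measurable_id.prodMk measurable_const)) fun z z' => by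
          have := hB (e (z', s)) 0 z
          rw [he'] at this
          simpa [he', Fin.update_cons_zero] using this)
      hG
    have hmean : ∫ q, (f ∘ e) q ∂((ν 0).prod π) = ∫ S, f S ∂(Measure.pi ν) :=
      mp.integral_comp' f
    rw [hmean] at key
    have mp' := (measurePreserving_piFinSuccAbove ν 0)
    rw [← mp'.map_eq] at key
    convert! HasSubgaussianMGF.of_map mp'.measurable.aemeasurable key using 1
    · funext S
      exact congrArg (fun S => f S - _) (e.apply_symm_apply S).symm
    · push_cast; ring

lemma hasSubgaussianMGF_pi {ι : Type*} [Fintype ι] [DecidableEq ι] {B : NNReal} {C : ℝ}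
    (ν : ι → Measure Z) [∀ i, IsProbabilityMeasure (ν i)] {f : (ι → Z) → ℝ} (hf : Measurable f)
    (hC : ∀ S, |f S| ≤ C) (hB : ∀ S i z, |f (Function.update S i z) - f S| ≤ B) :
    HasSubgaussianMGF (fun S => f S - ∫ S', f S' ∂(Measure.pi ν))
      (Fintype.card ι * (B / 2) ^ 2) (Measure.pi ν) := by
  let e := (Fintype.equivFin ι).symm
  have mp := measurePreserving_piCongrLeft ν e
  set E := MeasurableEquiv.piCongrLeft (fun _ : ι => Z) e
  have hE : ∀ S j, E S (e j) = S j := fun S j =>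
    Equiv.piCongrLeft_apply_apply (fun _ : ι => Z) e S j
  have hupd : ∀ S j z, E (Function.update S j z) = Function.update (E S) (e j) z := by
    intro S j z
    funext i
    obtain ⟨k, rfl⟩ := e.surjective i
    by_cases hk : k = j
    · subst hk; simp [hE]
    · rw [hE, Function.update_of_ne hk, Function.update_of_ne (e.injective.ne hk), hE]
  have key := hasSubgaussianMGF_pi_fin (C := C) (B := B) _ (fun j => ν (e j)) (f ∘ E)
    (hf.comp E.measurable) (fun S => hC _) (fun S j z => by
      simp only [Function.comp, hupd]; exact hB _ _ _)
  have hmean : ∫ q, (f ∘ E) q ∂(Measure.pi fun j => ν (e j)) = ∫ S, f S ∂(Measure.pi ν) :=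
    mp.integral_comp' f
  have mp' := mp.symm
  rw [hmean, ← mp'.map_eq] at key
  convert! HasSubgaussianMGF.of_map mp'.measurable.aemeasurable key using 1
  funext S
  exact congrArg (fun S => f S - _) (E.apply_symm_apply S).symm

/-- The Chernoff bound, solved for the deviation that is exceeded with probability `exp (-L)`. -/
lemma HasSubgaussianMGF.measureReal_sqrt_lt_le {P : Measure W} {X : W → ℝ} [IsFiniteMeasure P]
    {c : NNReal} (h : HasSubgaussianMGF X c P) {L : ℝ} (hL : 0 ≤ L) :
    P.real {w | Real.sqrt (2 * c * L) < X w} ≤ Real.exp (-L) := by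
  rcases eq_or_ne c 0 with rfl | hc
  · -- The Chernoff bound is vacuous for the parameter `0`, where `X` vanishes almost surely.
    have : P {w | Real.sqrt (2 * (0 : NNReal) * L) < X w} = 0 := by
      have h0 := h.ae_eq_zero_of_hasSubgaussianMGF_zero
      have : ∀ᵐ w ∂P, ¬ Real.sqrt (2 * (0 : NNReal) * L) < X w := by
        filter_upwards [h0] with w hw
        simp [hw]
      simpa [ae_iff] using this
    rw [measureReal_def, this]
    exact (Real.exp_pos _).le
  · have hc' : (0 : ℝ) < c := by positivity
    calc P.real {w | Real.sqrt (2 * c * L) < X w}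
        ≤ P.real {w | Real.sqrt (2 * c * L) ≤ X w} := measureReal_mono fun w (hw : _ < X w) => hw.le
      _ ≤ _ := h.measure_ge_le (Real.sqrt_nonneg _)
      _ = Real.exp (-L) := by
        rw [Real.sq_sqrt (by positivity)]
        congr 1
        field_simp

/-- **McDiarmid's inequality** for a function that changes by at most `B` when one coordinate is
replaced, in terms of the confidence `η`. -/
lemma measureReal_pi_lt_sub_integral_le {ι : Type*} [Fintype ι] [DecidableEq ι] {B C η : ℝ}
    (hB0 : 0 ≤ B) (ν : ι → Measure Z) [∀ i, IsProbabilityMeasure (ν i)] {f : (ι → Z) → ℝ}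
    (hf : Measurable f) (hC : ∀ S, |f S| ≤ C)
    (hB : ∀ S i z, |f (Function.update S i z) - f S| ≤ B) (hη : 0 < η) (hη1 : η ≤ 1) :
    (Measure.pi ν).real {S | B * Real.sqrt (Fintype.card ι * Real.log (1 / η) / 2) <
      f S - ∫ S', f S' ∂(Measure.pi ν)} ≤ η := by
  lift B to NNReal using hB0
  have hL : 0 ≤ Real.log (1 / η) := Real.log_nonneg (by rw [le_div_iff₀ hη]; linarith)
  have := HasSubgaussianMGF.measureReal_sqrt_lt_le (hasSubgaussianMGF_pi ν hf hC hB) hL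
  rw [one_div, Real.log_inv, neg_neg, Real.exp_log hη] at this
  convert this using 5
  rw [one_div, Real.log_inv]
  push_cast
  rw [show 2 * ((Fintype.card ι : ℝ) * ((B : ℝ) / 2) ^ 2) * -Real.log η =
    (B : ℝ) ^ 2 * (Fintype.card ι * -Real.log η / 2) by ring,
    Real.sqrt_mul (by positivity), Real.sqrt_sq (by positivity)]

end BoundedDifferences

/-! ### Rademacher averages of finite families of vectors -/

section Rademacher

open scoped BigOperators

variable {ι K : Type*} [Fintype ι] [DecidableEq ι]

/-- The Rademacher average `𝔼_σ sup_k ∑ i, σ i * a k i` of a family of vectors `a k`, where the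
signs `σ i` are independent and uniform. It is normalised neither by the number of coordinates nor
by a factor `2`. For an infinite index type `K` the supremum may be a junk value. -/
noncomputable def rademacherAvg (a : K → ι → ℝ) : ℝ :=
  𝔼 σ : ι → ℤˣ, ⨆ k, ∑ i, ((σ i : ℤ) : ℝ) * a k i

lemma abs_unitsInt_cast (s : ℤˣ) : |((s : ℤ) : ℝ)| = 1 := by
  rcases Int.units_eq_one_or s with rfl | rfl <;> simp

lemma rademacherAvg_const_mul {c : ℝ} (hc : 0 ≤ c) (a : K → ι → ℝ) :
    rademacherAvg (fun k i => c * a k i) = c * rademacherAvg a := by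
  rw [rademacherAvg, rademacherAvg, Finset.mul_expect]
  refine Finset.expect_congr rfl fun σ _ => ?_
  rw [Real.mul_iSup_of_nonneg hc]
  refine iSup_congr fun k => ?_
  rw [Finset.mul_sum]
  exact Finset.sum_congr rfl fun i _ => by ring

variable [Finite K]

lemma le_ciSup_of_finite (u : K → ℝ) (k : K) : u k ≤ ⨆ k, u k :=
  le_ciSup (Set.finite_range u).bddAbove k

variable [Nonempty K]

lemma ciSup_sub_ciSup_le {u v : K → ℝ} {B : ℝ} (h : ∀ k, u k - v k ≤ B) :
    (⨆ k, u k) - ⨆ k, v k ≤ B := by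
  rw [sub_le_iff_le_add]
  exact ciSup_le fun k => by linarith [h k, le_ciSup_of_finite v k]

lemma abs_ciSup_sub_ciSup_le {u v : K → ℝ} {B : ℝ} (h : ∀ k, |u k - v k| ≤ B) :
    |(⨆ k, u k) - ⨆ k, v k| ≤ B := by
  refine abs_sub_le_iff.2 ⟨ciSup_sub_ciSup_le fun k => (abs_le.1 (h k)).2,
    ciSup_sub_ciSup_le fun k => ?_⟩
  linarith [(abs_le.1 (h k)).1]

lemma abs_ciSup_le {u : K → ℝ} {B : ℝ} (h : ∀ k, |u k| ≤ B) : |⨆ k, u k| ≤ B := by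
  simpa using abs_ciSup_sub_ciSup_le (u := u) (v := fun _ => 0) (by simpa using h)

lemma abs_rademacherAvg_sub_le {a b : K → ι → ℝ} {B : ℝ} (h : ∀ k, ∑ i, |a k i - b k i| ≤ B) :
    |rademacherAvg a - rademacherAvg b| ≤ B := by
  rw [rademacherAvg, rademacherAvg, ← Finset.expect_sub_distrib]
  refine (Finset.abs_expect_le _ _).trans (Finset.expect_le Finset.univ_nonempty fun σ _ =>
    abs_ciSup_sub_ciSup_le fun k => ?_)
  rw [← Finset.sum_sub_distrib]
  refine (Finset.abs_sum_le_sum_abs _ _).trans (le_trans (le_of_eq ?_) (h k))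
  refine Finset.sum_congr rfl fun i _ => ?_
  rw [← mul_sub, abs_mul, abs_unitsInt_cast, one_mul]

/-- The signs have a symmetric law, so that a difference may be treated as a sum. -/
lemma rademacherAvg_sub_le (a b : K → ι → ℝ) :
    𝔼 σ : ι → ℤˣ, ⨆ k, ∑ i, ((σ i : ℤ) : ℝ) * (a k i - b k i) ≤
      rademacherAvg a + rademacherAvg b := by
  have hneg : rademacherAvg b = 𝔼 σ : ι → ℤˣ, ⨆ k, ∑ i, -((σ i : ℤ) : ℝ) * b k i :=
    Fintype.expect_equiv (Equiv.neg (ι → ℤˣ)) _ _ fun σ => by simp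
  rw [hneg, rademacherAvg, ← Finset.expect_add_distrib]
  refine Finset.expect_le_expect fun σ _ => ciSup_le fun k => ?_
  calc ∑ i, ((σ i : ℤ) : ℝ) * (a k i - b k i)
      = ∑ i, ((σ i : ℤ) : ℝ) * a k i + ∑ i, -((σ i : ℤ) : ℝ) * b k i := by
        rw [← Finset.sum_add_distrib]
        exact Finset.sum_congr rfl fun i _ => by ring
    _ ≤ _ := add_le_add (le_ciSup_of_finite (fun k => ∑ i, ((σ i : ℤ) : ℝ) * a k i) k)
        (le_ciSup_of_finite (fun k => ∑ i, -((σ i : ℤ) : ℝ) * b k i) k)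

/-- Averaging over the sign of one coordinate: adding a contraction of `b` instead of `b` with a
random sign does not increase the sum of the two suprema. -/
lemma ciSup_add_add_ciSup_sub_le (u a b : K → ℝ) (h : ∀ k k', |a k - a k'| ≤ |b k - b k'|) :
    (⨆ k, (u k + a k)) + ⨆ k, (u k - a k) ≤ (⨆ k, (u k + b k)) + ⨆ k, (u k - b k) := by
  suffices ∀ k k', (u k + a k) + (u k' - a k') ≤ (⨆ k, (u k + b k)) + ⨆ k, (u k - b k) by
    rw [← le_sub_iff_add_le]
    refine ciSup_le fun k => ?_
    rw [le_sub_iff_add_le, ← le_sub_iff_add_le']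
    exact ciSup_le fun k' => by linarith [this k k']
  intro k k'
  have h1 := le_ciSup_of_finite (fun k => u k + b k)
  have h2 := le_ciSup_of_finite (fun k => u k - b k)
  have h3 := (le_abs_self _).trans (h k k')
  rcases abs_cases (b k - b k') with ⟨hb, _⟩ | ⟨hb, _⟩ <;> rw [hb] at h3
  · linarith [h1 k, h2 k']
  · linarith [h1 k', h2 k]

/-- One step of the contraction principle, at the single coordinate `j`: every sign vector is paired
with the one that differs from it at `j`. -/
lemma rademacherAvg_update_le (a b : K → ι → ℝ) (j : ι) (haj : ∀ i ≠ j, ∀ k, a k i = b k i)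
    (h : ∀ k k', |a k j - a k' j| ≤ |b k j - b k' j|) :
    rademacherAvg a ≤ rademacherAvg b := by
  let flip : (ι → ℤˣ) ≃ (ι → ℤˣ) := Equiv.piCongrRight fun i =>
    if i = j then Equiv.neg ℤˣ else Equiv.refl ℤˣ
  have hflip : ∀ F : (ι → ℤˣ) → ℝ, 𝔼 σ, F σ = 𝔼 σ, (F σ + F (flip σ)) / 2 := fun F => by
    have : 𝔼 σ, F (flip σ) = 𝔼 σ, F σ := Fintype.expect_equiv flip _ _ fun σ => rfl
    rw [← Finset.expect_div, Finset.expect_add_distrib, this]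
    ring
  have hsplit : ∀ (d : K → ι → ℝ) (σ : ι → ℤˣ) (k : K), ∑ i, ((σ i : ℤ) : ℝ) * d k i =
      ∑ i ∈ Finset.univ.erase j, ((σ i : ℤ) : ℝ) * d k i + ((σ j : ℤ) : ℝ) * d k j :=
    fun d σ k => (Finset.sum_erase_add _ _ (Finset.mem_univ j)).symm
  have hrest : ∀ (d : K → ι → ℝ) (σ : ι → ℤˣ) (k : K), ∑ i, ((flip σ i : ℤ) : ℝ) * d k i =
      ∑ i ∈ Finset.univ.erase j, ((σ i : ℤ) : ℝ) * d k i - ((σ j : ℤ) : ℝ) * d k j := by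
    intro d σ k
    rw [hsplit, sub_eq_add_neg]
    congr 1
    · refine Finset.sum_congr rfl fun i hi => ?_
      simp [flip, Finset.ne_of_mem_erase hi]
    · simp [flip]
  rw [rademacherAvg, rademacherAvg, hflip, hflip fun σ => ⨆ k, ∑ i, ((σ i : ℤ) : ℝ) * b k i]
  refine Finset.expect_le_expect fun σ _ => div_le_div_of_nonneg_right ?_ (by norm_num)
  simp only [hrest]
  simp only [hsplit]
  have hu : ∀ k, ∑ i ∈ Finset.univ.erase j, ((σ i : ℤ) : ℝ) * a k i =
      ∑ i ∈ Finset.univ.erase j, ((σ i : ℤ) : ℝ) * b k i := fun k =>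
    Finset.sum_congr rfl fun i hi => by rw [haj i (Finset.ne_of_mem_erase hi)]
  simp only [hu]
  refine ciSup_add_add_ciSup_sub_le _ (fun k => ((σ j : ℤ) : ℝ) * a k j)
    (fun k => ((σ j : ℤ) : ℝ) * b k j) fun k k' => ?_
  rw [← mul_sub, ← mul_sub, abs_mul, abs_mul, abs_unitsInt_cast, one_mul, one_mul]
  exact h k k'

/-- The **contraction principle** for Rademacher averages. Only the increments along the family
matter, so that the coordinate maps `b k i ↦ a k i` need not be defined outside of it. -/
lemma rademacherAvg_le_of_abs_sub_le (a b : K → ι → ℝ)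
    (h : ∀ i k k', |a k i - a k' i| ≤ |b k i - b k' i|) :
    rademacherAvg a ≤ rademacherAvg b := by
  suffices ∀ s : Finset ι, rademacherAvg a ≤
      rademacherAvg fun k i => if i ∈ s then b k i else a k i by
    simpa using this Finset.univ
  intro s
  induction s using Finset.induction_on with
  | empty => simp
  | insert j s hj ih =>
    refine ih.trans (rademacherAvg_update_le _ _ j (fun i hi k => ?_) fun k k' => ?_)
    · simp [hi]
    · simpa [hj] using h j k k'

end Rademacher

/-! ### Symmetrization and the uniform deviation bound -/

section Symmetrization

open scoped BigOperators

variable {ι K Z : Type*} [Fintype ι] [MeasurableSpace Z]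

/-- Exchanging the entries at the coordinates of `J` between two independent copies of a sample
preserves their joint law. -/
lemma measurePreserving_pi_prod_exchange (ν : ι → Measure Z) [∀ i, IsProbabilityMeasure (ν i)]
    (J : ι → Prop) [DecidablePred J] :
    MeasurePreserving
      (fun q : (ι → Z) × (ι → Z) => ((fun i => if J i then q.1 i else q.2 i,
        fun i => if J i then q.2 i else q.1 i) : (ι → Z) × (ι → Z)))
      ((Measure.pi ν).prod (Measure.pi ν)) ((Measure.pi ν).prod (Measure.pi ν)) := by
  have mp := measurePreserving_arrowProdEquivProdArrow Z Z ι ν ν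
  have mpi : MeasurePreserving
      (fun (w : ι → Z × Z) i => (if J i then id else Prod.swap : Z × Z → Z × Z) (w i))
      (Measure.pi fun i => (ν i).prod (ν i)) (Measure.pi fun i => (ν i).prod (ν i)) :=
    measurePreserving_pi _ _ fun i => by
      by_cases h : J i
      · simpa [h] using MeasurePreserving.id _
      · simpa [h] using Measure.measurePreserving_swap
  convert! (mp.comp mpi).comp mp.symm using 1
  funext q
  refine Prod.ext (funext fun i => ?_) (funext fun i => ?_) <;>
  · by_cases h : J i <;>
      simp [h, MeasurableEquiv.arrowProdEquivProdArrow, Equiv.arrowProdEquivProdArrow]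

lemma abs_integral_le_of_abs_le {ρ : Measure Z} [IsProbabilityMeasure ρ] {f : Z → ℝ} {B : ℝ}
    (h : ∀ z, |f z| ≤ B) : |∫ z, f z ∂ρ| ≤ B := by
  simpa using norm_integral_le_of_norm_le_const (μ := ρ) (f := f) (Filter.Eventually.of_forall h)

variable [Finite K]

lemma measurable_ciSup_sum {Ω : Type*} [MeasurableSpace Ω] {f : K → ι → Ω → ℝ}
    (hf : ∀ k i, Measurable (f k i)) : Measurable fun w => ⨆ k, ∑ i, f k i w :=
  Measurable.iSup fun k => Finset.measurable_sum _ fun i _ => hf k i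

lemma measurable_rademacherAvg [DecidableEq ι] {Ω : Type*} [MeasurableSpace Ω] {f : K → ι → Ω → ℝ}
    (hf : ∀ k i, Measurable (f k i)) : Measurable fun w => rademacherAvg fun k i => f k i w := by
  simp only [rademacherAvg, Fintype.expect_eq_sum_div_card]
  exact (Finset.measurable_sum _ fun σ _ =>
    measurable_ciSup_sum fun k i => (hf k i).const_mul _).div_const _

variable [Nonempty K]

lemma abs_ciSup_sum_le {a : K → ι → ℝ} {B : ℝ} (h : ∀ k i, |a k i| ≤ B) :
    |⨆ k, ∑ i, a k i| ≤ Fintype.card ι * B := by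
  refine abs_ciSup_le fun k => (Finset.abs_sum_le_sum_abs _ _).trans ?_
  simpa using Finset.sum_le_card_nsmul _ _ _ fun i (_ : i ∈ Finset.univ) => h k i

variable [DecidableEq ι]

lemma abs_rademacherAvg_le {a : K → ι → ℝ} {B : ℝ} (h : ∀ k i, |a k i| ≤ B) :
    |rademacherAvg a| ≤ Fintype.card ι * B := by
  refine (Finset.abs_expect_le _ _).trans (Finset.expect_le Finset.univ_nonempty fun σ _ =>
    abs_ciSup_sum_le fun k i => ?_)
  rw [abs_mul, abs_unitsInt_cast, one_mul]
  exact h k i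

variable (ν : ι → Measure Z) [∀ i, IsProbabilityMeasure (ν i)] {g : K → ι → Z → ℝ} {B : ℝ}

/-- **Symmetrization**: in mean, the largest deviation of the sums from their expectations is at
most twice the Rademacher average. -/
lemma integral_ciSup_deviation_le (hg : ∀ k i, Measurable (g k i))
    (hB : ∀ k i z, |g k i z| ≤ B) :
    ∫ S, (⨆ k, ∑ i, ((∫ z, g k i z ∂(ν i)) - g k i (S i))) ∂(Measure.pi ν) ≤
      2 * ∫ S, rademacherAvg (fun k i => g k i (S i)) ∂(Measure.pi ν) := by
  set P := Measure.pi ν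
  have hgS : ∀ k i, Measurable fun S : ι → Z => g k i (S i) := fun k i =>
    (hg k i).comp (measurable_pi_apply i)
  have hint : ∀ k i, Integrable (fun S : ι → Z => g k i (S i)) P := fun k i =>
    Integrable.of_bound (hgS k i).aestronglyMeasurable B (Filter.Eventually.of_forall fun S =>
      hB _ _ _)
  -- `Ψ σ` compares the sample `q.2` with the independent copy `q.1`, with signs `σ`.
  let Ψ : (ι → ℤˣ) → (ι → Z) × (ι → Z) → ℝ := fun σ q =>
    ⨆ k, ∑ i, ((σ i : ℤ) : ℝ) * (g k i (q.1 i) - g k i (q.2 i))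
  have hΨm : ∀ σ, Measurable (Ψ σ) := fun σ => measurable_ciSup_sum fun k i =>
    (((hgS k i).comp measurable_fst).sub ((hgS k i).comp measurable_snd)).const_mul _
  have hΨb : ∀ σ q, |Ψ σ q| ≤ Fintype.card ι * (B + B) := fun σ q =>
    abs_ciSup_sum_le fun k i => by
      rw [abs_mul, abs_unitsInt_cast, one_mul]
      exact (abs_sub _ _).trans (add_le_add (hB _ _ _) (hB _ _ _))
  have hΨi : ∀ σ, Integrable (Ψ σ) (P.prod P) := fun σ =>
    Integrable.of_bound (hΨm σ).aestronglyMeasurable _ (Filter.Eventually.of_forall (hΨb σ))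
  have hRm : Measurable fun S : ι → Z => rademacherAvg fun k i => g k i (S i) :=
    measurable_rademacherAvg hgS
  have hRi : Integrable (fun S : ι → Z => rademacherAvg fun k i => g k i (S i)) P :=
    Integrable.of_bound hRm.aestronglyMeasurable (Fintype.card ι * B)
      (Filter.Eventually.of_forall fun S => abs_rademacherAvg_le fun k i => hB _ _ _)
  have hsym : ∀ σ, ∫ q, Ψ σ q ∂(P.prod P) = ∫ q, Ψ 1 q ∂(P.prod P) := by
    intro σ
    have mp := measurePreserving_pi_prod_exchange ν fun i => σ i = 1
    rw [← mp.map_eq, integral_map mp.measurable.aemeasurable (hΨm 1).aestronglyMeasurable,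
      mp.map_eq]
    refine integral_congr_ae (Filter.Eventually.of_forall fun q => ?_)
    refine iSup_congr fun k => Finset.sum_congr rfl fun i _ => ?_
    rcases Int.units_eq_one_or (σ i) with h | h <;> simp [h]
  -- The expectation is the mean over the independent copy, and the supremum is convex.
  have hghost : ∫ S, (⨆ k, ∑ i, ((∫ z, g k i z ∂(ν i)) - g k i (S i))) ∂P ≤
      ∫ q, Ψ 1 q ∂(P.prod P) := by
    rw [integral_prod_symm _ (hΨi 1)]
    refine integral_mono ?_ (hΨi 1).integral_prod_right fun S => ?_
    · refine Integrable.of_bound (measurable_ciSup_sum fun k i =>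
        measurable_const.sub (hgS k i)).aestronglyMeasurable (Fintype.card ι * (B + B))
        (Filter.Eventually.of_forall fun S => abs_ciSup_sum_le fun k i =>
          (abs_sub _ _).trans (add_le_add (abs_integral_le_of_abs_le (hB k i)) (hB _ _ _)))
    · refine ciSup_le fun k => ?_
      have hmean : ∀ i, ∫ z, g k i z ∂(ν i) = ∫ S', g k i (S' i) ∂P := fun i =>
        (integral_comp_eval (hg k i).aestronglyMeasurable).symm
      have : ∑ i, ((∫ z, g k i z ∂(ν i)) - g k i (S i)) =
          ∫ S', ∑ i, (g k i (S' i) - g k i (S i)) ∂P := by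
        rw [integral_finsetSum Finset.univ (f := fun i (S' : ι → Z) => g k i (S' i) - g k i (S i))
          fun i _ => (hint k i).sub (integrable_const _)]
        refine Finset.sum_congr rfl fun i _ => ?_
        rw [integral_sub (hint k i) (integrable_const _), hmean]
        simp
      rw [this]
      refine integral_mono (integrable_finsetSum _ fun i _ => (hint k i).sub (integrable_const _))
        (Integrable.of_bound ((hΨm 1).comp (measurable_id.prodMk
          measurable_const)).aestronglyMeasurable _ (Filter.Eventually.of_forall fun S' =>
            hΨb 1 (S', S))) fun S' => ?_
      simpa [Ψ] using le_ciSup_of_finite (fun k => ∑ i, (g k i (S' i) - g k i (S i))) k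
  calc _ ≤ ∫ q, Ψ 1 q ∂(P.prod P) := hghost
    _ = 𝔼 σ, ∫ q, Ψ σ q ∂(P.prod P) := by
      simp only [hsym]
      rw [Finset.expect_const Finset.univ_nonempty]
    _ = ∫ q, 𝔼 σ, Ψ σ q ∂(P.prod P) := by
      simp only [Fintype.expect_eq_sum_div_card]
      rw [integral_div, integral_finsetSum _ fun σ _ => hΨi σ]
    _ ≤ ∫ q, (rademacherAvg (fun k i => g k i (q.1 i)) +
          rademacherAvg (fun k i => g k i (q.2 i))) ∂(P.prod P) := by
      refine integral_mono ?_ ((hRi.comp_fst P).add (hRi.comp_snd P)) fun q => rademacherAvg_sub_le _ _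
      simp only [Fintype.expect_eq_sum_div_card]
      exact (integrable_finsetSum _ fun σ _ => hΨi σ).div_const _
    _ = 2 * ∫ S, rademacherAvg (fun k i => g k i (S i)) ∂P := by
      rw [integral_add (hRi.comp_fst P) (hRi.comp_snd P)]
      have h1 := integral_fun_fst (μ := P) (ν := P)
        (fun S : ι → Z => rademacherAvg fun k i => g k i (S i))
      have h2 := integral_fun_snd (μ := P) (ν := P)
        (fun S : ι → Z => rademacherAvg fun k i => g k i (S i))
      simp only [probReal_univ, one_smul] at h1 h2
      rw [h1, h2, two_mul]

/-- With probability at least `1 - δ`, every deviation of a sum from its expectation is bounded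
by twice the empirical Rademacher average, up to a fluctuation term. The factor `3` arises as
`1 + 2`: the bounded differences inequality is applied to the largest deviation and to the
Rademacher average, which enters with the factor `2`, each at the level `δ / 2`. -/
lemma measureReal_exists_deviation_le {δ : ℝ} (hδ : 0 < δ) (hδ1 : δ ≤ 1)
    (hg : ∀ k i, Measurable (g k i)) (h0 : ∀ k i z, 0 ≤ g k i z) (hB : ∀ k i z, g k i z ≤ B)
    (hB0 : 0 ≤ B) :
    (Measure.pi ν).real {S | ∃ k, 2 * rademacherAvg (fun k i => g k i (S i)) +
      3 * B * Real.sqrt (Fintype.card ι * Real.log (2 / δ) / 2) <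
        ∑ i, ((∫ z, g k i z ∂(ν i)) - g k i (S i))} ≤ δ := by
  have habs : ∀ k i z, |g k i z| ≤ B := fun k i z => by
    rw [abs_of_nonneg (h0 k i z)]; exact hB k i z
  have hgS : ∀ k i, Measurable fun S : ι → Z => g k i (S i) := fun k i =>
    (hg k i).comp (measurable_pi_apply i)
  have hupd : ∀ k (S : ι → Z) j z, ∑ i, |g k i (Function.update S j z i) - g k i (S i)| ≤ B := by
    intro k S j z
    rw [Finset.sum_eq_single j (fun i _ hi => by simp [hi]) (by simp)]
    rw [Function.update_self, abs_sub_le_iff]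
    constructor <;> linarith [h0 k j z, hB k j z, h0 k j (S j), hB k j (S j)]
  set Φ : (ι → Z) → ℝ := fun S => ⨆ k, ∑ i, ((∫ z, g k i z ∂(ν i)) - g k i (S i)) with hΦ
  set R : (ι → Z) → ℝ := fun S => rademacherAvg fun k i => g k i (S i) with hR
  have hd : 0 < δ / 2 := by positivity
  have hd1 : δ / 2 ≤ 1 := by linarith
  have hlog : 1 / (δ / 2) = 2 / δ := by field_simp
  have h1 := measureReal_pi_lt_sub_integral_le (f := Φ) (B := B) (C := Fintype.card ι * (B + B))
    hB0 ν (measurable_ciSup_sum fun k i => measurable_const.sub (hgS k i))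
    (fun S => abs_ciSup_sum_le fun k i => (abs_sub _ _).trans (add_le_add
      (abs_integral_le_of_abs_le (habs k i)) (habs _ _ _)))
    (fun S j z => abs_ciSup_sub_ciSup_le fun k => by
      rw [← Finset.sum_sub_distrib]
      refine (Finset.abs_sum_le_sum_abs _ _).trans (le_trans (le_of_eq ?_) (hupd k S j z))
      refine Finset.sum_congr rfl fun i _ => ?_
      rw [sub_sub_sub_cancel_left, abs_sub_comm]) hd hd1
  have h2 := measureReal_pi_lt_sub_integral_le (f := fun S => -R S) (B := B)
    (C := Fintype.card ι * B) hB0 ν (measurable_rademacherAvg hgS).neg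
    (fun S => by rw [abs_neg]; exact abs_rademacherAvg_le fun k i => habs _ _ _)
    (fun S j z => by
      rw [neg_sub_neg, abs_sub_comm]
      exact abs_rademacherAvg_sub_le fun k => hupd k S j z) hd hd1
  have hsymm : ∫ S, Φ S ∂(Measure.pi ν) ≤ 2 * ∫ S, R S ∂(Measure.pi ν) :=
    integral_ciSup_deviation_le ν hg habs
  rw [hlog] at h1 h2
  rw [integral_neg] at h2
  refine (measureReal_mono fun S hS => ?_).trans
    ((measureReal_union_le _ _).trans ((add_le_add h1 h2).trans_eq (add_halves δ)))
  obtain ⟨k, hk⟩ := hS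
  by_contra hn
  rw [Set.mem_union, not_or, Set.mem_ofPred_eq, Set.mem_ofPred_eq, not_lt, not_lt] at hn
  have hΦk := le_ciSup_of_finite (fun k => ∑ i, ((∫ z, g k i z ∂(ν i)) - g k i (S i))) k
  have hn1 := hn.1
  simp only [hΦ] at hn1 hsymm
  simp only [hR] at hn hsymm
  linarith [hn.2]

end Symmetrization

/-! ### The Rademacher average of the linear predictors -/

section LinearClass

open scoped BigOperators

section SecondMoment

variable {ι E : Type*} [Fintype ι] [DecidableEq ι] [NormedAddCommGroup E] [InnerProductSpace ℝ E]

lemma expect_sign_mul_sign {i j : ι} (hij : i ≠ j) :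
    𝔼 σ : ι → ℤˣ, ((σ i : ℤ) : ℝ) * ((σ j : ℤ) : ℝ) = 0 := by
  let flip : (ι → ℤˣ) ≃ (ι → ℤˣ) := Equiv.piCongrRight fun k =>
    if k = i then Equiv.neg ℤˣ else Equiv.refl ℤˣ
  have : 𝔼 σ : ι → ℤˣ, ((σ i : ℤ) : ℝ) * ((σ j : ℤ) : ℝ) =
      𝔼 σ : ι → ℤˣ, -(((σ i : ℤ) : ℝ) * ((σ j : ℤ) : ℝ)) :=
    Fintype.expect_equiv flip _ _ fun σ => by simp [flip, hij.symm]
  rw [Finset.expect_neg_distrib] at this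
  linarith

/-- Distinct signs are uncorrelated, so that only the diagonal terms survive. -/
lemma expect_norm_sq_sum_sign_smul (s : Finset ι) (x : ι → E) :
    𝔼 σ : ι → ℤˣ, ‖∑ i ∈ s, ((σ i : ℤ) : ℝ) • x i‖ ^ 2 = ∑ i ∈ s, ‖x i‖ ^ 2 := by
  simp only [← real_inner_self_eq_norm_sq, sum_inner, inner_sum, real_inner_smul_left,
    real_inner_smul_right]
  rw [Finset.expect_sum_comm]
  refine Finset.sum_congr rfl fun i hi => ?_
  rw [Finset.expect_sum_comm, Finset.sum_eq_single i]
  · refine (Finset.expect_congr rfl fun σ _ => ?_).trans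
      (Finset.expect_const Finset.univ_nonempty _)
    rcases Int.units_eq_one_or (σ i) with h | h <;> simp [h]
  · intro j _ hj
    simp only [← mul_assoc]
    rw [← Finset.expect_mul, expect_sign_mul_sign hj.symm, zero_mul]
  · exact fun h => absurd hi h

/-- Jensen's inequality for the square root on a finite uniform probability space. -/
lemma expect_sqrt_le {Ω : Type*} [Fintype Ω] [Nonempty Ω] {F : Ω → ℝ} (hF : ∀ w, 0 ≤ F w) :
    𝔼 w, Real.sqrt (F w) ≤ Real.sqrt (𝔼 w, F w) := by
  refine Real.le_sqrt_of_sq_le ?_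
  rw [Fintype.expect_eq_sum_div_card, Fintype.expect_eq_sum_div_card, div_pow,
    div_le_div_iff₀ (by positivity) (by positivity)]
  have := sq_sum_le_card_mul_sum_sq (s := Finset.univ) (f := fun w => Real.sqrt (F w))
  simp only [Real.sq_sqrt (hF _), Finset.card_univ] at this
  have hc : (0 : ℝ) ≤ Fintype.card Ω := by positivity
  nlinarith [mul_le_mul_of_nonneg_right this hc]

end SecondMoment

variable {d T : ℕ}

lemma predictor_eq_inner (A : Matrix (Fin d) (Fin T) ℝ) (a₀ : EuclideanSpace ℝ (Fin d))
    (U : Matrix (Fin d) (Fin d) ℝ) (t : Fin T) (x : EuclideanSpace ℝ (Fin d)) :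
    predictor A a₀ U t x =
      inner ℝ (WithLp.toLp 2 fun i => A i t) (Matrix.toEuclideanLin U.transpose x) +
        inner ℝ a₀ (Matrix.toEuclideanLin U.transpose x) := by
  rw [← inner_add_left]
  rfl

lemma norm_toEuclideanLin_transpose {U : Matrix (Fin d) (Fin d) ℝ}
    (hU : U ∈ Matrix.orthogonalGroup (Fin d) ℝ) (x : EuclideanSpace ℝ (Fin d)) :
    ‖Matrix.toEuclideanLin U.transpose x‖ = ‖x‖ := by
  have h := Matrix.mem_orthogonalGroup_iff (Fin d) ℝ |>.1 hU
  have hsq : ∀ y : EuclideanSpace ℝ (Fin d), ‖y‖ ^ 2 = y.ofLp ⬝ᵥ y.ofLp := fun y => by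
    rw [EuclideanSpace.real_norm_sq_eq]
    exact Finset.sum_congr rfl fun i _ => by ring
  rw [← sq_eq_sq₀ (norm_nonneg _) (norm_nonneg _), hsq, hsq]
  change (U.transpose.mulVec x.ofLp) ⬝ᵥ (U.transpose.mulVec x.ofLp) = _
  rw [Matrix.dotProduct_mulVec, Matrix.vecMul_transpose, Matrix.mulVec_mulVec]
  rw [show U * U.transpose = 1 from h, Matrix.one_mulVec]

/-- The Frobenius norm of a matrix is at most its `(2, 1)`-norm. -/
lemma sum_norm_sq_col_le (A : Matrix (Fin d) (Fin T) ℝ) :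
    ∑ t, ‖(WithLp.toLp 2 fun i => A i t : EuclideanSpace ℝ (Fin d))‖ ^ 2 ≤ norm21 A ^ 2 := by
  simp only [EuclideanSpace.real_norm_sq_eq]
  rw [Finset.sum_comm]
  calc ∑ i, ∑ t, A i t ^ 2
      = ∑ i, ‖(WithLp.toLp 2 fun t => A i t : EuclideanSpace ℝ (Fin T))‖ ^ 2 := by
        simp only [EuclideanSpace.real_norm_sq_eq]
    _ ≤ _ := Finset.sum_sq_le_sq_sum_of_nonneg fun i _ => norm_nonneg _

variable {m : Fin T → ℕ} {γ β : ℝ}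

/-- For fixed weights `s p`, the orthogonal matrix drops out: the columns of `A` meet the weighted
feature sums of their own tasks, and `a₀` meets the weighted sum over all tasks. -/
lemma sum_mul_predictor_le {A : Matrix (Fin d) (Fin T) ℝ} {a₀ : EuclideanSpace ℝ (Fin d)}
    {U : Matrix (Fin d) (Fin d) ℝ} (hf : Feasible γ β A a₀ U)
    (x : (Σ t : Fin T, Fin (m t)) → EuclideanSpace ℝ (Fin d))
    (s : (Σ t : Fin T, Fin (m t)) → ℝ) :
    ∑ p, s p * predictor A a₀ U p.1 (x p) ≤
      Real.sqrt ((T : ℝ) / γ) * Real.sqrt (∑ t, ‖∑ p with p.1 = t, s p • x p‖ ^ 2) +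
        Real.sqrt (1 / β) * Real.sqrt (‖∑ p, s p • x p‖ ^ 2) := by
  obtain ⟨hU, hA, ha⟩ := hf
  set V := Matrix.toEuclideanLin U.transpose with hV
  have hVn : ∀ y, ‖V y‖ = ‖y‖ := norm_toEuclideanLin_transpose hU
  simp only [predictor_eq_inner, mul_add, Finset.sum_add_distrib, ← hV]
  refine add_le_add ?_ ?_
  · calc ∑ p, s p * inner ℝ (WithLp.toLp 2 fun i => A i p.1) (V (x p))
        = ∑ t, inner ℝ (WithLp.toLp 2 fun i => A i t) (V (∑ p with p.1 = t, s p • x p)) := by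
          rw [← Finset.sum_fiberwise Finset.univ Sigma.fst]
          refine Finset.sum_congr rfl fun t _ => ?_
          rw [map_sum, inner_sum]
          refine Finset.sum_congr rfl fun p hp => ?_
          rw [map_smul, real_inner_smul_right, (Finset.mem_filter.1 hp).2]
      _ ≤ ∑ t, ‖(WithLp.toLp 2 fun i => A i t : EuclideanSpace ℝ (Fin d))‖ *
            ‖∑ p with p.1 = t, s p • x p‖ := by
          refine Finset.sum_le_sum fun t _ => (real_inner_le_norm _ _).trans_eq ?_
          rw [hVn]
      _ ≤ _ := Real.sum_mul_le_sqrt_mul_sqrt _ _ _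
      _ ≤ _ := mul_le_mul_of_nonneg_right
          (Real.sqrt_le_sqrt ((sum_norm_sq_col_le A).trans hA)) (Real.sqrt_nonneg _)
  · calc ∑ p, s p * inner ℝ a₀ (V (x p)) = inner ℝ a₀ (V (∑ p, s p • x p)) := by
          rw [map_sum, inner_sum]
          exact Finset.sum_congr rfl fun p _ => by rw [map_smul, real_inner_smul_right]
      _ ≤ ‖a₀‖ * ‖V (∑ p, s p • x p)‖ := real_inner_le_norm _ _
      _ ≤ _ := by
          rw [hVn, Real.sqrt_sq (norm_nonneg _)]
          exact mul_le_mul_of_nonneg_right (Real.le_sqrt_of_sq_le ha) (norm_nonneg _)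

/-- Both the task-wise and the total signed feature sums have mean square `∑ p, ‖x p‖ ^ 2`; the
sharing across tasks shows only in the different radii of `A` and `a₀`. -/
lemma rademacherAvg_predictor_le {K : Type*} [Nonempty K]
    {A : K → Matrix (Fin d) (Fin T) ℝ} {a₀ : K → EuclideanSpace ℝ (Fin d)}
    {U : K → Matrix (Fin d) (Fin d) ℝ} (hf : ∀ k, Feasible γ β (A k) (a₀ k) (U k))
    (x : (Σ t : Fin T, Fin (m t)) → EuclideanSpace ℝ (Fin d)) :
    rademacherAvg (fun k p => predictor (A k) (a₀ k) (U k) p.1 (x p)) ≤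
      (Real.sqrt ((T : ℝ) / γ) + Real.sqrt (1 / β)) * Real.sqrt (∑ p, ‖x p‖ ^ 2) := by
  calc _ ≤ 𝔼 σ : (Σ t : Fin T, Fin (m t)) → ℤˣ,
        (Real.sqrt ((T : ℝ) / γ) *
            Real.sqrt (∑ t, ‖∑ p with p.1 = t, ((σ p : ℤ) : ℝ) • x p‖ ^ 2) +
          Real.sqrt (1 / β) * Real.sqrt (‖∑ p, ((σ p : ℤ) : ℝ) • x p‖ ^ 2)) :=
        Finset.expect_le_expect fun σ _ => ciSup_le fun k =>
          sum_mul_predictor_le (hf k) x _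
    _ ≤ Real.sqrt ((T : ℝ) / γ) * Real.sqrt (𝔼 σ : (Σ t : Fin T, Fin (m t)) → ℤˣ,
            ∑ t, ‖∑ p with p.1 = t, ((σ p : ℤ) : ℝ) • x p‖ ^ 2) +
          Real.sqrt (1 / β) * Real.sqrt (𝔼 σ : (Σ t : Fin T, Fin (m t)) → ℤˣ,
            ‖∑ p, ((σ p : ℤ) : ℝ) • x p‖ ^ 2) := by
        rw [Finset.expect_add_distrib, ← Finset.mul_expect, ← Finset.mul_expect]
        exact add_le_add
          (mul_le_mul_of_nonneg_left (expect_sqrt_le fun σ => by positivity)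
            (Real.sqrt_nonneg _))
          (mul_le_mul_of_nonneg_left (expect_sqrt_le fun σ => by positivity)
            (Real.sqrt_nonneg _))
    _ = _ := by
        rw [Finset.expect_sum_comm]
        simp only [expect_norm_sq_sum_sign_smul]
        rw [Finset.sum_fiberwise, add_mul]

end LinearClass

/-! ### The uniform bound over all feasible parameters -/

section Uniform

variable {d T : ℕ} {m : Fin T → ℕ} {γ β : ℝ}

/-- The feasible triples `(A, a₀, U)`, with the topology of their entries. -/
abbrev FeasibleParam (d T : ℕ) (γ β : ℝ) : Type :=
  {θ : Matrix (Fin d) (Fin T) ℝ × EuclideanSpace ℝ (Fin d) × Matrix (Fin d) (Fin d) ℝ //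
    Feasible γ β θ.1 θ.2.1 θ.2.2}

/-- The predictor of task `t` for a feasible triple. -/
noncomputable abbrev FeasibleParam.predict (θ : FeasibleParam d T γ β) (t : Fin T) :
    EuclideanSpace ℝ (Fin d) → ℝ :=
  predictor θ.1.1 θ.1.2.1 θ.1.2.2 t

lemma FeasibleParam.predict_mem (θ : FeasibleParam d T γ β) (t : Fin T) :
    θ.predict t ∈ hypothesisClass d T γ β :=
  ⟨_, _, _, t, θ.2, rfl⟩

instance : SecondCountableTopology (FeasibleParam d T γ β) := by
  have h : ∀ n k : ℕ, SecondCountableTopology (Matrix (Fin n) (Fin k) ℝ) := fun n k =>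
    inferInstanceAs (SecondCountableTopology (Fin n → Fin k → ℝ))
  have := h d T
  have := h d d
  unfold FeasibleParam
  exact TopologicalSpace.Subtype.secondCountableTopology _

lemma nonempty_feasibleParam (hγ : 0 < γ) (hβ : 0 < β) : Nonempty (FeasibleParam d T γ β) :=
  ⟨⟨(0, 0, 1), one_mem _, by
    have : norm21 (0 : Matrix (Fin d) (Fin T) ℝ) = 0 :=
      Finset.sum_eq_zero fun i _ => norm_eq_zero.2 (by ext; simp)
    simp only [this, zero_pow two_ne_zero]; positivity, by simp [hβ.le]⟩⟩

lemma predictor_eq_sum (A : Matrix (Fin d) (Fin T) ℝ) (a₀ : EuclideanSpace ℝ (Fin d))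
    (U : Matrix (Fin d) (Fin d) ℝ) (t : Fin T) (x : EuclideanSpace ℝ (Fin d)) :
    predictor A a₀ U t x = ∑ i, (∑ j, U j i * x j) * (A i t + a₀ i) := by
  simp [predictor, PiLp.inner_apply, Matrix.mulVec, dotProduct]

lemma continuous_predict_param (t : Fin T) (x : EuclideanSpace ℝ (Fin d)) :
    Continuous fun θ : FeasibleParam d T γ β => θ.predict t x := by
  simp only [FeasibleParam.predict, predictor_eq_sum]
  have hA : ∀ i, Continuous fun θ : FeasibleParam d T γ β => θ.1.1 i t := fun i =>
    (continuous_fst.comp continuous_subtype_val).matrix_elem i t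
  have hU : ∀ j i, Continuous fun θ : FeasibleParam d T γ β => θ.1.2.2 j i := fun j i =>
    ((continuous_snd.comp continuous_snd).comp continuous_subtype_val).matrix_elem j i
  have ha : ∀ i, Continuous fun θ : FeasibleParam d T γ β => θ.1.2.1 i := fun i => by fun_prop
  exact continuous_finsetSum _ fun i _ =>
    (continuous_finsetSum _ fun j _ => (hU j i).mul continuous_const).mul ((hA i).add (ha i))

lemma measurable_loss_predict {l : ℝ → ℝ → ℝ} (hl : Measurable (Function.uncurry l))
    (θ : FeasibleParam d T γ β) (t : Fin T) :
    Measurable fun z : Example d => l z.2 (θ.predict t z.1) := by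
  have hp : Measurable fun x : EuclideanSpace ℝ (Fin d) => θ.predict t x := by
    simp only [FeasibleParam.predict, predictor_eq_sum]
    fun_prop
  exact hl.comp (measurable_snd.prodMk (hp.comp measurable_fst))

lemma continuous_loss_predict {l : ℝ → ℝ → ℝ} {c : ℝ} {D : Set (Example d)}
    (hc : IsAdmissible l c (hypothesisClass d T γ β) D) (t : Fin T) {z : Example d} (hz : z ∈ D) :
    Continuous fun θ : FeasibleParam d T γ β => l z.2 (θ.predict t z.1) := by
  refine continuous_iff_continuousAt.2 fun θ₀ => tendsto_iff_dist_tendsto_zero.2 ?_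
  have h0 : Filter.Tendsto (fun θ : FeasibleParam d T γ β =>
      c * |θ.predict t z.1 - θ₀.predict t z.1|) (nhds θ₀) (nhds 0) := by
    have : Continuous fun θ : FeasibleParam d T γ β => c * |θ.predict t z.1 - θ₀.predict t z.1| :=
      continuous_const.mul ((continuous_predict_param t z.1).sub continuous_const).abs
    simpa using this.tendsto θ₀
  exact squeeze_zero (fun _ => dist_nonneg)
    (fun θ => hc.2 _ (θ.predict_mem t) _ (θ₀.predict_mem t) z hz) h0

/-- Continuity from below, for unions of initial segments of a sequence of events. -/
lemma measureReal_iUnion_le_of_forall_initial {Ω : Type*} [MeasurableSpace Ω] {P : Measure Ω}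
    [IsFiniteMeasure P] {C : ℕ → Set Ω} {δ : ℝ}
    (h : ∀ n, P.real {w | ∃ j : Fin (n + 1), w ∈ C j} ≤ δ) : P.real (⋃ j, C j) ≤ δ := by
  have hδ : 0 ≤ δ := measureReal_nonneg.trans (h 0)
  have hU : ⋃ j, C j = ⋃ n : ℕ, {w | ∃ j : Fin (n + 1), w ∈ C j} := by
    ext w
    simp only [Set.mem_iUnion, Set.mem_ofPred_eq]
    exact ⟨fun ⟨j, hj⟩ => ⟨j, ⟨j, j.lt_succ_self⟩, hj⟩, fun ⟨_, j, hj⟩ => ⟨j, hj⟩⟩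
  have hmono : Monotone fun n : ℕ => {w | ∃ j : Fin (n + 1), w ∈ C j} := fun a b hab w ⟨j, hj⟩ =>
    ⟨⟨j, j.2.trans_le (Nat.succ_le_succ hab)⟩, hj⟩
  rw [hU]
  refine ENNReal.toReal_le_of_le_ofReal hδ ?_
  rw [hmono.measure_iUnion]
  exact iSup_le fun n => (ENNReal.le_ofReal_iff_toReal_le (measure_ne_top _ _) hδ).2 (h n)

/-- The deviation bound with all examples listed in one sum. It is obtained for the finite initial
segments of a dense sequence of feasible triples, passes to the whole sequence because the bound
does not depend on the segment, and extends to all triples by continuity. This also provides the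
measurability of the event. -/
lemma exists_measurableSet_forall_feasible {μ : Fin T → Measure (Example d)}
    [∀ t, IsProbabilityMeasure (μ t)] {D : Set (Example d)} (hD : ∀ t, ∀ᵐ z ∂(μ t), z ∈ D)
    {l : ℝ → ℝ → ℝ} (hl : Measurable (Function.uncurry l)) (hγ : 0 < γ) (hβ : 0 < β) {B c : ℝ}
    (hB : IsBoundedLoss l B (hypothesisClass d T γ β) D)
    (hc : IsAdmissible l c (hypothesisClass d T γ β) D) {δ : ℝ} (hδ : 0 < δ) (hT : 0 < T) :
    ∃ E : Set (Sample d T m), MeasurableSet E ∧ 1 - δ ≤ (sampleLaw μ m).real E ∧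
      ∀ S ∈ E, ∀ θ : FeasibleParam d T γ β,
        ∑ p : Σ t : Fin T, Fin (m t), ((∫ z, l z.2 (θ.predict p.1 z.1) ∂(μ p.1)) -
            l (S p).2 (θ.predict p.1 (S p).1)) ≤
          2 * c * (Real.sqrt ((T : ℝ) / γ) + Real.sqrt (1 / β)) *
              Real.sqrt (∑ p, ‖(S p).1‖ ^ 2) +
            3 * B * Real.sqrt (Fintype.card (Σ t : Fin T, Fin (m t)) * Real.log (2 / δ) / 2) := by
  -- For `1 < δ` the required probability is negative, and the empty event will do.
  rcases lt_or_ge 1 δ with hδ1 | hδ1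
  · exact ⟨∅, MeasurableSet.empty, by simpa using hδ1.le, fun S hS => absurd hS (by simp)⟩
  have hne := nonempty_feasibleParam (d := d) (T := T) hγ hβ
  set ι := Σ t : Fin T, Fin (m t)
  have : IsProbabilityMeasure (sampleLaw μ m) := by unfold sampleLaw; infer_instance
  let t₀ : Fin T := ⟨0, hT⟩
  have hB0 : 0 ≤ B := by
    obtain ⟨z, hz⟩ := (hD t₀).exists
    obtain ⟨θ⟩ := hne
    have := hB _ (θ.predict_mem t₀) z hz
    exact this.1.trans this.2
  choose D' hD'mem hD'm hD'D using fun t => (hD t).exists_measurable_mem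
  let θ := TopologicalSpace.denseSeq (FeasibleParam d T γ β)
  let L : FeasibleParam d T γ β → ι → Example d → ℝ := fun θ p z => l z.2 (θ.predict p.1 z.1)
  have hLm : ∀ θ p, Measurable (L θ p) := fun θ p => measurable_loss_predict hl θ p.1
  have hLB : ∀ θ p, ∀ z ∈ D, 0 ≤ L θ p z ∧ L θ p z ≤ B := fun θ p z hz =>
    hB _ (θ.predict_mem p.1) z hz
  -- Outside of `D` the loss is uncontrolled, and is replaced by `0`.
  let g : FeasibleParam d T γ β → ι → Example d → ℝ := fun θ p => (D' p.1).indicator (L θ p)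
  have hgm : ∀ θ p, Measurable (g θ p) := fun θ p => (hLm θ p).indicator (hD'm p.1)
  have hg0 : ∀ θ p z, 0 ≤ g θ p z := fun θ p z =>
    Set.indicator_nonneg (fun z hz => (hLB θ p z (hD'D _ _ hz)).1) z
  have hgB : ∀ θ p z, g θ p z ≤ B := fun θ p z =>
    Set.indicator_le' (fun z hz => (hLB θ p z (hD'D _ _ hz)).2) (fun _ _ => hB0) z
  have hgL : ∀ θ p, ∫ z, g θ p z ∂(μ p.1) = ∫ z, L θ p z ∂(μ p.1) := fun θ p =>
    integral_congr_ae (by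
      filter_upwards [hD'mem p.1] with z hz
      exact Set.indicator_of_mem hz _)
  let bound : Sample d T m → ℝ := fun S =>
    2 * c * (Real.sqrt ((T : ℝ) / γ) + Real.sqrt (1 / β)) * Real.sqrt (∑ p, ‖(S p).1‖ ^ 2) +
      3 * B * Real.sqrt (Fintype.card ι * Real.log (2 / δ) / 2)
  let dev : FeasibleParam d T γ β → Sample d T m → ℝ := fun θ S =>
    ∑ p, ((∫ z, L θ p z ∂(μ p.1)) - L θ p (S p))
  have hboundm : Measurable bound := by fun_prop
  have hdevm : ∀ θ, Measurable (dev θ) := fun θ => Finset.measurable_sum _ fun p _ =>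
    measurable_const.sub ((hLm θ p).comp (measurable_pi_apply p))
  let G : Set (Sample d T m) := {S | ∀ p, S p ∈ D' p.1}
  have hGm : MeasurableSet G := by
    have : G = ⋂ p, (fun S : Sample d T m => S p) ⁻¹' D' p.1 := by ext; simp [G]
    rw [this]
    exact MeasurableSet.iInter fun p => measurable_pi_apply p (hD'm p.1)
  have hGae : ∀ᵐ S ∂(sampleLaw μ m), S ∈ G := by
    refine ae_all_iff.2 fun p => ?_
    exact (measurePreserving_eval (fun p : ι => μ p.1) p).quasiMeasurePreserving.ae (hD'mem p.1)
  let C : ℕ → Set (Sample d T m) := fun j => G ∩ {S | bound S < dev (θ j) S}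
  have hCm : ∀ j, MeasurableSet (C j) := fun j =>
    hGm.inter (measurableSet_lt hboundm (hdevm _))
  have hCδ : (sampleLaw μ m).real (⋃ j, C j) ≤ δ := by
    refine measureReal_iUnion_le_of_forall_initial fun n => le_trans (measureReal_mono ?_)
      (measureReal_exists_deviation_le (K := Fin (n + 1)) (fun p : ι => μ p.1)
        (g := fun k => g (θ k)) hδ hδ1 (fun k => hgm _) (fun k => hg0 _) (fun k => hgB _) hB0)
    rintro S ⟨k, hSG, hS⟩
    refine ⟨k, lt_of_le_of_lt ?_ (lt_of_lt_of_eq hS ?_)⟩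
    · refine add_le_add ?_ le_rfl
      have hcontr : rademacherAvg (fun (k : Fin (n + 1)) i => g (θ k) i (S i)) ≤
          c * rademacherAvg (fun (k : Fin (n + 1)) i => (θ k).predict i.1 (S i).1) := by
        rw [← rademacherAvg_const_mul hc.1]
        refine rademacherAvg_le_of_abs_sub_le _ _ fun i k k' => ?_
        simp only [g, Set.indicator_of_mem (hSG i)]
        rw [← mul_sub, abs_mul, abs_of_nonneg hc.1]
        exact hc.2 _ ((θ k).predict_mem _) _ ((θ k').predict_mem _) _ (hD'D _ _ (hSG i))
      have hlin := rademacherAvg_predictor_le (fun k : Fin (n + 1) => (θ k).2) fun p => (S p).1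
      calc _ ≤ 2 * (c * _) := mul_le_mul_of_nonneg_left
            (hcontr.trans (mul_le_mul_of_nonneg_left hlin hc.1)) zero_le_two
        _ = _ := by ring
    · refine Finset.sum_congr rfl fun p _ => ?_
      simp only [hgL, g, Set.indicator_of_mem (hSG p)]
  refine ⟨G ∩ (⋃ j, C j)ᶜ, hGm.inter (MeasurableSet.iUnion hCm).compl, ?_, ?_⟩
  · have hcongr : (G ∩ (⋃ j, C j)ᶜ : Set _) =ᵐ[sampleLaw μ m] ((⋃ j, C j)ᶜ : Set _) :=
      inter_ae_eq_right_of_ae_eq_univ (Filter.eventuallyEq_univ.2 hGae)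
    rw [measureReal_congr hcongr, probReal_compl_eq_one_sub (MeasurableSet.iUnion hCm)]
    linarith
  · rintro S ⟨hSG, hSC⟩
    have hdense : ∀ j, dev (θ j) S ≤ bound S := fun j => not_lt.1 fun h =>
      hSC (Set.mem_iUnion.2 ⟨j, hSG, h⟩)
    -- The features need not be integrable, so the Lipschitz bound does not pass to the means;
    -- the loss is bounded, however, and dominated convergence applies.
    have hcont : Continuous fun θ => dev θ S := by
      refine continuous_finsetSum _ fun p _ => Continuous.sub ?_
        (continuous_loss_predict hc p.1 (hD'D _ _ (hSG p)))
      refine continuous_of_dominated (bound := fun _ => B)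
        (fun θ => (hLm θ p).aestronglyMeasurable) (fun θ => ?_) (integrable_const _) ?_
      · filter_upwards [hD p.1] with z hz
        rw [Real.norm_eq_abs, abs_of_nonneg (hLB θ p z hz).1]
        exact (hLB θ p z hz).2
      · filter_upwards [hD p.1] with z hz using continuous_loss_predict hc p.1 hz
    exact fun θ' => (TopologicalSpace.denseRange_denseSeq _).induction_on θ'
      (isClosed_le hcont continuous_const) hdense

end Uniform

/-! ### Totals and averages over the tasks -/

section Totals

variable {d T : ℕ} {m : Fin T → ℕ} {γ β : ℝ}

lemma empiricalLoss_eq_sum (l : ℝ → ℝ → ℝ) (A : Matrix (Fin d) (Fin T) ℝ)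
    (a₀ : EuclideanSpace ℝ (Fin d)) (U : Matrix (Fin d) (Fin d) ℝ) (S : Sample d T m) :
    empiricalLoss l A a₀ U S =
      ∑ p : Σ t : Fin T, Fin (m t), l (S p).2 (predictor A a₀ U p.1 (S p).1) :=
  (Fintype.sum_sigma fun p : Σ t : Fin T, Fin (m t) =>
    l (S p).2 (predictor A a₀ U p.1 (S p).1)).symm

lemma sum_mul_covTrace (S : Sample d T m) :
    ∑ t, (m t : ℝ) * covTrace S t = ∑ p, ‖(S p).1‖ ^ 2 := by
  rw [Fintype.sum_sigma]
  refine Finset.sum_congr rfl fun t _ => ?_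
  rw [covTrace, ← mul_assoc, mul_one_div]
  rcases Nat.eq_zero_or_pos (m t) with h | h
  · have : IsEmpty (Fin (m t)) := by rw [h]; infer_instance
    simp
  · rw [div_self (by positivity), one_mul]

lemma integrable_loss_predict {μ : Measure (Example d)} [IsProbabilityMeasure μ]
    {D : Set (Example d)} (hD : ∀ᵐ z ∂μ, z ∈ D) {l : ℝ → ℝ → ℝ}
    (hl : Measurable (Function.uncurry l)) {B : ℝ}
    (hB : IsBoundedLoss l B (hypothesisClass d T γ β) D) (θ : FeasibleParam d T γ β) (t : Fin T) :
    Integrable (fun z => l z.2 (θ.predict t z.1)) μ := by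
  refine Integrable.of_bound (measurable_loss_predict hl θ t).aestronglyMeasurable B ?_
  filter_upwards [hD] with z hz
  have := hB _ (θ.predict_mem t) z hz
  rw [Real.norm_eq_abs, abs_of_nonneg this.1]
  exact this.2

lemma integral_empiricalLoss {μ : Fin T → Measure (Example d)} [∀ t, IsProbabilityMeasure (μ t)]
    {D : Set (Example d)} (hD : ∀ t, ∀ᵐ z ∂(μ t), z ∈ D) {l : ℝ → ℝ → ℝ}
    (hl : Measurable (Function.uncurry l)) {B : ℝ}
    (hB : IsBoundedLoss l B (hypothesisClass d T γ β) D) (θ : FeasibleParam d T γ β) :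
    ∫ S, empiricalLoss l θ.1.1 θ.1.2.1 θ.1.2.2 S ∂(sampleLaw μ m) =
      ∑ p : Σ t : Fin T, Fin (m t), ∫ z, l z.2 (θ.predict p.1 z.1) ∂(μ p.1) := by
  simp only [empiricalLoss_eq_sum]
  have hint := fun p : Σ t : Fin T, Fin (m t) => integrable_loss_predict (hD p.1) hl hB θ p.1
  have hint' : ∀ p : Σ t : Fin T, Fin (m t), Integrable
      (fun S : Sample d T m => l (S p).2 (θ.predict p.1 (S p).1)) (Measure.pi fun p => μ p.1) :=
    fun p => integrable_comp_eval (μ := fun p : Σ t : Fin T, Fin (m t) => μ p.1) (i := p) (hint p)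
  rw [sampleLaw, integral_finsetSum _ fun p _ => hint' p]
  exact Finset.sum_congr rfl fun p _ =>
    integral_comp_eval (μ := fun p : Σ t : Fin T, Fin (m t) => μ p.1) (i := p)
      (hint p).aestronglyMeasurable

/-- Dividing the bound for the total loss by the number `n * T` of examples. -/
lemma div_total_bound_eq {n T γ β B c r Λ : ℝ} (hn : 0 < n) (hT : 0 < T) (hγ : 0 < γ)
    (hβ : 0 < β) (hr : 0 ≤ r) :
    (2 * c * (Real.sqrt (T / γ) + Real.sqrt (1 / β)) * Real.sqrt (n * T * r ^ 2) +
      3 * B * Real.sqrt (n * T * Λ / 2)) / (n * T) =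
    2 * c * r / Real.sqrt (γ * n) + 2 * c * r / Real.sqrt (β * n * T) +
      3 * B * Real.sqrt (Λ / (2 * n * T)) := by
  have hN : 0 < n * T := by positivity
  have h0 : Real.sqrt (n * T * r ^ 2) = Real.sqrt (n * T) * r := by
    rw [Real.sqrt_mul hN.le, Real.sqrt_sq hr]
  have h1 : Real.sqrt (T / γ) * Real.sqrt (n * T) / (n * T) = 1 / Real.sqrt (γ * n) := by
    rw [← Real.sqrt_mul (by positivity), div_eq_div_iff hN.ne' (by positivity),
      ← Real.sqrt_mul (by positivity), one_mul,
      show T / γ * (n * T) * (γ * n) = (n * T) ^ 2 by field_simp, Real.sqrt_sq hN.le]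
  have h2 : Real.sqrt (1 / β) * Real.sqrt (n * T) / (n * T) = 1 / Real.sqrt (β * n * T) := by
    rw [← Real.sqrt_mul (by positivity), div_eq_div_iff hN.ne' (by positivity),
      ← Real.sqrt_mul (by positivity), one_mul,
      show 1 / β * (n * T) * (β * n * T) = (n * T) ^ 2 by field_simp, Real.sqrt_sq hN.le]
  have h3 : Real.sqrt (n * T * Λ / 2) / (n * T) = Real.sqrt (Λ / (2 * n * T)) := by
    rw [show n * T * Λ / 2 = (n * T) ^ 2 * (Λ / (2 * n * T)) by field_simp,
      Real.sqrt_mul (by positivity), Real.sqrt_sq hN.le, mul_div_cancel_left₀ _ hN.ne']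
  calc _ = 2 * c * r * (Real.sqrt (T / γ) * Real.sqrt (n * T) / (n * T)) +
        2 * c * r * (Real.sqrt (1 / β) * Real.sqrt (n * T) / (n * T)) +
        3 * B * (Real.sqrt (n * T * Λ / 2) / (n * T)) := by rw [h0]; ring
    _ = _ := by rw [h1, h2, h3]; ring

end Totals

end MTMF

theorem theorem2 (d T : ℕ) (m : Fin T → ℕ)
    (μ : Fin T → Measure (MTMF.Example d)) [∀ t, IsProbabilityMeasure (μ t)]
    (D : Set (MTMF.Example d)) (hD : ∀ t, ∀ᵐ z ∂(μ t), z ∈ D)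
    (l : ℝ → ℝ → ℝ) (hl : Measurable (Function.uncurry l))
    (γ β : ℝ) (hγ : 0 < γ) (hβ : 0 < β)
    (B c : ℝ)
    (hB : MTMF.IsBoundedLoss l B (MTMF.hypothesisClass d T γ β) D)
    (hc : MTMF.IsAdmissible l c (MTMF.hypothesisClass d T γ β) D)
    (δ : ℝ) (hδ : 0 < δ) :
    (∃ E : Set (MTMF.Sample d T m), MeasurableSet E ∧ 1 - δ ≤ (MTMF.sampleLaw μ m).real E ∧
      ∀ S ∈ E, ∀ (A : Matrix (Fin d) (Fin T) ℝ) (a₀ : EuclideanSpace ℝ (Fin d))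
        (U : Matrix (Fin d) (Fin d) ℝ), MTMF.Feasible γ β A a₀ U →
        (∫ S', MTMF.empiricalLoss l A a₀ U S' ∂(MTMF.sampleLaw μ m))
            - MTMF.empiricalLoss l A a₀ U S
          ≤ 2 * c * (Real.sqrt ((T : ℝ) / γ) + Real.sqrt (1 / β))
                * Real.sqrt (∑ t, (m t : ℝ) * MTMF.covTrace S t)
              + 3 * B * Real.sqrt ((∑ t, (m t : ℝ)) * Real.log (2 / δ) / 2)) ∧
    (∀ (n : ℕ) (r : ℝ), 0 < T → 0 < n → (∀ t, m t = n) → (∀ t, ∀ᵐ z ∂(μ t), ‖z.1‖ ≤ r) →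
      ∃ E : Set (MTMF.Sample d T m), MeasurableSet E ∧ 1 - δ ≤ (MTMF.sampleLaw μ m).real E ∧
      ∀ S ∈ E, ∀ (A : Matrix (Fin d) (Fin T) ℝ) (a₀ : EuclideanSpace ℝ (Fin d))
        (U : Matrix (Fin d) (Fin d) ℝ), MTMF.Feasible γ β A a₀ U →
        1 / (T : ℝ) * (∑ t, ∫ z, l z.2 (MTMF.predictor A a₀ U t z.1) ∂(μ t))
            - 1 / (T : ℝ) * (∑ t, 1 / (n : ℝ) *
                ∑ i : Fin (m t), l (S ⟨t, i⟩).2 (MTMF.predictor A a₀ U t (S ⟨t, i⟩).1))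
          ≤ 2 * c * r / Real.sqrt (γ * n) + 2 * c * r / Real.sqrt (β * n * T)
              + 3 * B * Real.sqrt (Real.log (2 / δ) / (2 * n * T))) := by
  constructor
  -- Without tasks both sides vanish; the sign of `B` is then unknown, but its factor is zero.
  · rcases Nat.eq_zero_or_pos T with rfl | hT
    · have : IsProbabilityMeasure (MTMF.sampleLaw μ m) := by
        unfold MTMF.sampleLaw; infer_instance
      exact ⟨Set.univ, MeasurableSet.univ, by simpa using hδ.le, fun S _ A a₀ U _ => by
        simp [MTMF.empiricalLoss]⟩
    obtain ⟨E, hE, hEδ, h⟩ :=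
      MTMF.exists_measurableSet_forall_feasible (m := m) hD hl hγ hβ hB hc hδ hT
    refine ⟨E, hE, hEδ, fun S hS A a₀ U hf => ?_⟩
    have key := h S hS ⟨(A, a₀, U), hf⟩
    rw [Finset.sum_sub_distrib] at key
    have hint := MTMF.integral_empiricalLoss (m := m) hD hl hB ⟨(A, a₀, U), hf⟩
    rw [← hint, ← MTMF.sum_mul_covTrace] at key
    rw [MTMF.empiricalLoss_eq_sum l A a₀ U S]
    simpa [Fintype.card_sigma] using key
  · intro n r hT hn hmn hr
    obtain rfl : m = fun _ => n := funext hmn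
    have hr0 : 0 ≤ r := by
      obtain ⟨z, hz⟩ := (hr ⟨0, hT⟩).exists
      exact (norm_nonneg _).trans hz
    obtain ⟨E, hE, hEδ, h⟩ :=
      MTMF.exists_measurableSet_forall_feasible (m := fun _ => n) hD hl hγ hβ hB hc hδ hT
    have hnorm : ∀ᵐ S ∂(MTMF.sampleLaw μ fun _ => n), ∀ p, ‖(S p).1‖ ≤ r :=
      ae_all_iff.2 fun p => (measurePreserving_eval
        (fun p : Σ _ : Fin T, Fin n => μ p.1) p).quasiMeasurePreserving.ae (hr p.1)
    obtain ⟨G, hG, hGm, hGr⟩ := hnorm.exists_measurable_mem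
    -- Intersecting with the almost sure event that all features are bounded by `r` is free.
    have hcongr : (G ∩ E : Set _) =ᵐ[MTMF.sampleLaw μ fun _ => n] E :=
      inter_ae_eq_right_of_ae_eq_univ (Filter.eventuallyEq_univ.2 hG)
    refine ⟨G ∩ E, hGm.inter hE, by rwa [measureReal_congr hcongr],
      fun S hS A a₀ U hf => ?_⟩
    have key := h S hS.2 ⟨(A, a₀, U), hf⟩
    have hn' : (0 : ℝ) < n := by exact_mod_cast hn
    have hT' : (0 : ℝ) < T := by exact_mod_cast hT
    have hcard : (Fintype.card (Σ _ : Fin T, Fin n) : ℝ) = n * T := by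
      simp [Fintype.card_sigma, mul_comm]
    have hsq : ∑ p, ‖(S p).1‖ ^ 2 ≤ n * T * r ^ 2 := by
      have := Finset.sum_le_card_nsmul Finset.univ (fun p => ‖(S p).1‖ ^ 2) (r ^ 2)
        fun p _ => pow_le_pow_left₀ (norm_nonneg _) (hGr S hS.1 p) 2
      rwa [nsmul_eq_mul, Finset.card_univ, hcard] at this
    have hc0 := hc.1
    rw [← MTMF.div_total_bound_eq hn' hT' hγ hβ hr0, le_div_iff₀ (by positivity)]
    rw [hcard] at key
    refine le_trans (le_of_eq ?_) (key.trans (add_le_add_left (mul_le_mul_of_nonneg_left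
      (Real.sqrt_le_sqrt hsq) (by positivity)) _))
    rw [Fintype.sum_sigma]
    simp only [Finset.sum_sub_distrib, Finset.sum_const, Finset.card_univ, Fintype.card_fin,
      nsmul_eq_mul, ← Finset.mul_sum]
    field_simp
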